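/- **Theorem 4.1.** Let $G$ be a finite simple connected graph that is cubic (every vertex has degree $3$) and bridgeless (no edge of $G$ is a bridge), and let $t\ge 1$ be an integer. If $$|E(G)| < \frac{2^t}{\sqrt t},$$ then there are $t$ perfect matchings $M_1,\dots,M_t$ of $G$, not necessarily distinct, such that every edge of $G$ belongs to at least one of them, i.e. $E(G)=M_1\cup\dots\cup M_t$. -/

import Mathlib

namespace SimpleGraph

/-- A graph is bridgeless if none of its edges is a bridge. -/
def IsBridgeless {V : Type*} (G : SimpleGraph V) : Prop :=
  ∀ e ∈ G.edgeSet, ¬ G.IsBridge e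

/-- The edge set of `G` is covered by `t` perfect matchings (not necessarily distinct): every edge
of `G` lies in at least one of them. -/
def IsCoveredByPerfectMatchings {V : Type*} (G : SimpleGraph V) (t : ℕ) : Prop :=
  ∃ M : Fin t → G.Subgraph,
    (∀ i, (M i).IsPerfectMatching) ∧ ⋃ i, (M i).edgeSet = G.edgeSet

end SimpleGraph

open Finset

namespace PerfectMatchingPolytope

/-! The matchings are chosen greedily. Let A be the adjacency matrix and let M_1, …, M_i be already
chosen; put N = (i+1)A − ΣM_j. The rows of N sum to 2i+3, N equals i+1 on every uncovered edge, and
N/(2i+3) lies in Edmonds' perfect matching polytope. Writing this point as a convex combination of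
perfect matchings and averaging yields one that covers at least the fraction (i+1)/(2i+3) of the
uncovered edges (`IsFractionalMatching.exists_matching_le`). It crosses tight odd cuts exactly once,
while odd cuts of G have at least 3 edges and parity leaves slack 2 in the other odd cuts, so the
next N is again of this kind (`IsResidualWeight.exists_step`). After t steps at most |E|·∏_{i<t}
(i+2)/(2i+3) edges are uncovered, which is less than 1 by `mul_prod_lt_one`.

Edmonds' theorem (`IsFractionalMatching.mem_convexHull`) goes by induction on |V|. By Krein–Milman
only extreme points matter. If some nontrivial odd cut is tight, contract either side and glue the
two decompositions. Otherwise a perfect matching in the support, given by Tutte's theorem, can be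
split off with small positive weight, so the extreme point is that matching. -/

/-- The total weight of the ordered pairs leaving the vertex set `X`. -/
def cutSum {V R : Type*} [Fintype V] [DecidableEq V] [AddCommMonoid R]
    (x : V → V → R) (X : Finset V) : R :=
  ∑ a ∈ X, ∑ b ∈ Xᶜ, x a b

/-- The adjacency matrix of a perfect matching of the complete graph on `V`. -/
structure IsMatchingMatrix {V : Type*} [Fintype V] (M : V → V → ℤ) : Prop where
  zero_or_one : ∀ a b, M a b = 0 ∨ M a b = 1
  symm : ∀ a b, M a b = M b a
  diag : ∀ a, M a a = 0
  row_sum : ∀ a, ∑ b, M a b = 1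

/-- A fractional perfect matching satisfying the odd cut inequalities: a point of Edmonds'
perfect matching polytope of the complete graph on `V`. -/
structure IsFractionalMatching {V : Type*} [Fintype V] [DecidableEq V] (x : V → V → ℝ) :
    Prop where
  nonneg : ∀ a b, 0 ≤ x a b
  symm : ∀ a b, x a b = x b a
  diag : ∀ a, x a a = 0
  row_sum : ∀ a, ∑ b, x a b = 1
  one_le_cutSum : ∀ X : Finset V, Odd #X → 1 ≤ cutSum x X

variable {V : Type*} [Fintype V] [DecidableEq V]

/-! ### Cuts and their parity -/

section cutSum

variable {R : Type*}

lemma cutSum_compl [AddCommMonoid R] {x : V → V → R} (hx : ∀ a b, x a b = x b a)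
    (X : Finset V) : cutSum x Xᶜ = cutSum x X := by
  unfold cutSum
  rw [compl_compl, sum_comm]
  exact sum_congr rfl fun a _ => sum_congr rfl fun b _ => hx b a

lemma cutSum_singleton [AddCommGroup R] {x : V → V → R} (hx : ∀ a, x a a = 0) (a : V) :
    cutSum x {a} = ∑ b, x a b := by
  simp [cutSum, hx, ← sum_add_sum_compl {a} (x a)]

lemma cutSum_eq_sub [AddCommGroup R] (x : V → V → R) (X : Finset V) :
    cutSum x X = ∑ a ∈ X, ∑ b, x a b - ∑ a ∈ X, ∑ b ∈ X, x a b := by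
  rw [← sum_sub_distrib, cutSum]
  refine sum_congr rfl fun a _ => ?_
  rw [← sum_add_sum_compl X, add_sub_cancel_left]

lemma cutSum_intCast (N : V → V → ℤ) (X : Finset V) :
    cutSum (fun a b => (N a b : ℝ)) X = (cutSum N X : ℤ) := by
  simp [cutSum]

omit [Fintype V] [DecidableEq V] in
-- Modulo 2 the entries at (a, b) and (b, a) cancel, and the diagonal vanishes.
lemma even_sum_of_symm {N : V → V → ℤ} (hs : ∀ a b, N a b = N b a) (hd : ∀ a, N a a = 0)
    (X : Finset V) : Even (∑ a ∈ X, ∑ b ∈ X, N a b) := by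
  rw [← ZMod.intCast_eq_zero_iff_even, ← sum_product', Int.cast_sum]
  refine sum_involution (fun p _ => p.swap) ?_ ?_ ?_ ?_
  · rintro ⟨a, b⟩ _
    simp only [Prod.swap_prod_mk, hs b a]
    exact CharTwo.add_self_eq_zero _
  · rintro ⟨a, b⟩ _ h h'
    simp only [Prod.swap_prod_mk, Prod.mk.injEq] at h'
    obtain ⟨rfl, -⟩ := h'
    simp [hd] at h
  · rintro ⟨a, b⟩ h
    simpa [and_comm] using h
  · simp

lemma odd_cutSum {N : V → V → ℤ} (hs : ∀ a b, N a b = N b a) (hd : ∀ a, N a a = 0)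
    {r : ℤ} (hr : Odd r) (hrow : ∀ a, ∑ b, N a b = r) {X : Finset V} (hX : Odd #X) :
    Odd (cutSum N X) := by
  rw [cutSum_eq_sub, sum_congr rfl fun a _ => hrow a, sum_const, nsmul_eq_mul]
  exact (((Int.odd_coe_nat _).2 hX).mul hr).sub_even (even_sum_of_symm hs hd X)

lemma cutSum_nonneg {x : V → V → ℤ} (hx : ∀ a b, 0 ≤ x a b) (X : Finset V) :
    0 ≤ cutSum x X :=
  sum_nonneg fun _ _ => sum_nonneg fun _ _ => hx _ _

end cutSum

omit [DecidableEq V] in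
lemma IsMatchingMatrix.nonneg {M : V → V → ℤ} (hM : IsMatchingMatrix M) (a b : V) :
    0 ≤ M a b := by
  rcases hM.zero_or_one a b with h | h <;> simp [h]

lemma IsMatchingMatrix.one_le_cutSum {M : V → V → ℤ} (hM : IsMatchingMatrix M)
    {X : Finset V} (hX : Odd #X) : 1 ≤ cutSum M X := by
  have h := odd_cutSum hM.symm hM.diag odd_one hM.row_sum hX
  have h0 := cutSum_nonneg hM.nonneg X
  obtain ⟨k, hk⟩ := h
  omega

lemma IsMatchingMatrix.isFractionalMatching {M : V → V → ℤ} (hM : IsMatchingMatrix M) :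
    IsFractionalMatching fun a b => (M a b : ℝ) where
  nonneg a b := by exact_mod_cast hM.nonneg a b
  symm a b := by rw [hM.symm]
  diag a := by simp [hM.diag]
  row_sum a := by exact_mod_cast hM.row_sum a
  one_le_cutSum X hX := by
    rw [cutSum_intCast]
    exact_mod_cast hM.one_le_cutSum hX

/-! ### Perfect matchings in the support, by Tutte's theorem -/

namespace IsFractionalMatching

variable {x : V → V → ℝ}

/-- The whole vertex set has an empty cut, so it cannot be odd. -/
lemma even_card (hx : IsFractionalMatching x) : Even (Fintype.card V) := by
  by_contra h
  have := hx.one_le_cutSum univ (by simpa using h)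
  simp [cutSum] at this
  linarith

lemma odd_card_compl (hx : IsFractionalMatching x) {X : Finset V} (hX : Odd #X) :
    Odd #Xᶜ := by
  have h := hx.even_card
  rw [← card_add_card_compl X, Nat.even_add'] at h
  exact h.1 hX

/-- The graph of the pairs of positive weight. -/
def supportGraph (hx : IsFractionalMatching x) : SimpleGraph V where
  Adj a b := 0 < x a b
  symm := ⟨fun a b h => by rwa [hx.symm]⟩
  loopless := ⟨fun a h => by simp [hx.diag] at h⟩

/-- Each odd component left after deleting `u` has cut weight at least 1, all of it going into `u`.
The vertices of `u` absorb at most `|u|` in total. -/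
lemma not_isTutteViolator (hx : IsFractionalMatching x) (u : Set V) :
    ¬ hx.supportGraph.IsTutteViolator u := by
  classical
  unfold SimpleGraph.IsTutteViolator
  rw [not_lt]
  set H := ((⊤ : hx.supportGraph.Subgraph).deleteVerts u).coe with hH
  let S : Finset H.ConnectedComponent := univ.filter fun c => Odd c.supp.ncard
  have hS : H.oddComponents.ncard = #S := by
    rw [← Set.ncard_coe_finset]
    congr 1
    ext c
    simp [S]
  let K : H.ConnectedComponent → Finset V := fun c => univ.filter fun v => v ∈ Subtype.val '' c.supp
  have hK : ∀ c ∈ S, 1 ≤ ∑ a ∈ K c, ∑ b ∈ u.toFinset, x a b := by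
    intro c hc
    have hodd : Odd #(K c) := by
      have : ((K c : Finset V) : Set V) = Subtype.val '' c.supp := by ext; simp [K]
      rw [← Set.ncard_coe_finset, this, Set.ncard_image_of_injective _ Subtype.val_injective]
      simpa [S] using hc
    refine (hx.one_le_cutSum _ hodd).trans (sum_le_sum fun a ha => ?_)
    have hau : ∀ b ∈ (K c)ᶜ, b ∉ u.toFinset → x a b = 0 := by
      intro b hb hbu
      by_contra hne
      have hpos : 0 < x a b := lt_of_le_of_ne (hx.nonneg a b) (Ne.symm hne)
      obtain ⟨a', ha', rfl⟩ := (mem_filter.1 ha).2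
      have hbv : b ∈ ((⊤ : hx.supportGraph.Subgraph).deleteVerts u).verts := by
        simpa using hbu
      have hadj : H.Adj a' ⟨b, hbv⟩ := by
        have h1 := a'.2
        simp only [SimpleGraph.Subgraph.deleteVerts_verts, SimpleGraph.Subgraph.verts_top] at h1
        rw [hH, SimpleGraph.Subgraph.coe_adj, SimpleGraph.Subgraph.deleteVerts_adj]
        refine ⟨trivial, h1.2, trivial, by simpa using hbu, hpos⟩
      refine (mem_compl.1 hb) (mem_filter.2 ⟨mem_univ _, ⟨b, hbv⟩, ?_, rfl⟩)
      exact SimpleGraph.ConnectedComponent.mem_supp_of_adj_mem_supp _ ha' hadj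
    rw [← sum_filter_add_sum_filter_not (K c)ᶜ (· ∈ u.toFinset),
      sum_eq_zero (s := (K c)ᶜ.filter _) fun b hb => hau b (mem_filter.1 hb).1 (mem_filter.1 hb).2,
      add_zero]
    exact sum_le_sum_of_subset_of_nonneg (fun b hb => (mem_filter.1 hb).2)
      fun b _ _ => hx.nonneg a b
  have hdisj : (S : Set H.ConnectedComponent).PairwiseDisjoint K := by
    intro c _ d _ hcd
    rw [Function.onFun, disjoint_left]
    intro v hv hv'
    obtain ⟨v₁, h₁, rfl⟩ := (mem_filter.1 hv).2
    obtain ⟨v₂, h₂, h⟩ := (mem_filter.1 hv').2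
    obtain rfl := Subtype.val_injective h
    exact hcd (h₁.symm.trans h₂)
  have key : (#S : ℝ) ≤ (u.ncard : ℝ) := by
    calc (#S : ℝ) = ∑ c ∈ S, (1 : ℝ) := by simp
      _ ≤ ∑ c ∈ S, ∑ a ∈ K c, ∑ b ∈ u.toFinset, x a b := sum_le_sum hK
      _ = ∑ a ∈ S.biUnion K, ∑ b ∈ u.toFinset, x a b := (sum_biUnion hdisj).symm
      _ ≤ ∑ a, ∑ b ∈ u.toFinset, x a b :=
        sum_le_sum_of_subset_of_nonneg (subset_univ _)
          fun a _ _ => sum_nonneg fun b _ => hx.nonneg a b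
      _ = ∑ b ∈ u.toFinset, ∑ a, x b a := by
        rw [sum_comm]
        exact sum_congr rfl fun b _ => sum_congr rfl fun a _ => hx.symm a b
      _ = (u.ncard : ℝ) := by
        rw [sum_congr rfl fun b _ => hx.row_sum b, Set.ncard_eq_toFinset_card']
        simp
  rw [hS]
  exact_mod_cast key

/-- A point of the perfect matching polytope has a perfect matching in its support. -/
lemma exists_isMatchingMatrix (hx : IsFractionalMatching x) :
    ∃ M : V → V → ℤ, IsMatchingMatrix M ∧ ∀ a b, M a b ≠ 0 → 0 < x a b := by
  classical
  obtain ⟨M, hM⟩ := SimpleGraph.tutte.2 hx.not_isTutteViolator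
  rw [SimpleGraph.Subgraph.isPerfectMatching_iff] at hM
  refine ⟨fun a b => if M.Adj a b then 1 else 0, ⟨?_, ?_, ?_, ?_⟩, ?_⟩
  · intro a b
    by_cases h : M.Adj a b <;> simp [h]
  · intro a b
    simp only [M.adj_comm]
  · intro a
    exact if_neg fun h => h.ne rfl
  · intro a
    obtain ⟨b, hb, hb'⟩ := hM a
    rw [sum_eq_single b]
    · simp [hb]
    · intro c _ hc
      exact if_neg fun h => hc (hb' c h)
    · simp
  · intro a b h
    have h' : M.Adj a b := by by_contra h'; simp [h'] at h
    exact h'.adj_sub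

end IsFractionalMatching

end PerfectMatchingPolytope

namespace PerfectMatchingPolytope

universe u

variable {V : Type u} [Fintype V] [DecidableEq V]

/-- The real adjacency matrices of perfect matchings. -/
def matchingMatrices (V : Type*) [Fintype V] : Set (V → V → ℝ) :=
  {x | ∃ M : V → V → ℤ, IsMatchingMatrix M ∧ x = fun a b => (M a b : ℝ)}

omit [DecidableEq V] in
lemma finite_matchingMatrices : (matchingMatrices V).Finite := by
  have h : {M : V → V → ℤ | ∀ a, M a ∈ {r : V → ℤ | ∀ b, r b ∈ ({0, 1} : Set ℤ)}}.Finite :=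
    Set.Finite.pi' fun a => Set.Finite.pi' fun b => Set.toFinite _
  refine (h.image fun M a b => (M a b : ℝ)).subset ?_
  rintro _ ⟨M, hM, rfl⟩
  exact ⟨M, fun a b => by simpa using hM.zero_or_one a b, rfl⟩

/-! ### Coupling two distributions -/

section coupling

/-- A nonnegative table of masses is induced by a coupling of two distributions whose images are
its marginals. -/
lemma exists_coupling {α β ι κ : Type*} [DecidableEq α] [DecidableEq β] [Fintype ι] [Fintype κ]
    {X : Finset α} {Y : Finset β} {x : α → β → ℝ} (hx : ∀ a b, 0 ≤ x a b)
    {p : ι → ℝ} {q : κ → ℝ} (hp : ∀ i, 0 ≤ p i) (hq : ∀ j, 0 ≤ q j) {f : ι → α} {g : κ → β}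
    (hf : ∀ i, f i ∈ X) (hg : ∀ j, g j ∈ Y)
    (hpx : ∀ a ∈ X, ∑ i with f i = a, p i = ∑ b ∈ Y, x a b)
    (hqx : ∀ b ∈ Y, ∑ j with g j = b, q j = ∑ a ∈ X, x a b) :
    ∃ w : ι → κ → ℝ, (∀ i j, 0 ≤ w i j) ∧ (∀ i, ∑ j, w i j = p i) ∧ (∀ j, ∑ i, w i j = q j) ∧
      ∀ a ∈ X, ∀ b ∈ Y, ∑ i with f i = a, ∑ j with g j = b, w i j = x a b := by
  set r : α → ℝ := fun a => ∑ b ∈ Y, x a b with hr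
  set c : β → ℝ := fun b => ∑ a ∈ X, x a b with hc
  have hr0 : ∀ a, 0 ≤ r a := fun a => sum_nonneg fun b _ => hx a b
  have hc0 : ∀ b, 0 ≤ c b := fun b => sum_nonneg fun a _ => hx a b
  have hxr : ∀ a, ∀ b ∈ Y, r a = 0 → x a b = 0 := fun a b hb h =>
    (sum_eq_zero_iff_of_nonneg fun b _ => hx a b).1 h b hb
  have hxc : ∀ b, ∀ a ∈ X, c b = 0 → x a b = 0 := fun b a ha h =>
    (sum_eq_zero_iff_of_nonneg fun a _ => hx a b).1 h a ha
  have hpr : ∀ i, r (f i) = 0 → p i = 0 := fun i h => by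
    change ∑ b ∈ Y, x (f i) b = 0 at h
    rw [← hpx _ (hf i)] at h
    exact (sum_eq_zero_iff_of_nonneg fun i _ => hp i).1 h i (by simp)
  have hqc : ∀ j, c (g j) = 0 → q j = 0 := fun j h => by
    change ∑ a ∈ X, x a (g j) = 0 at h
    rw [← hqx _ (hg j)] at h
    exact (sum_eq_zero_iff_of_nonneg fun j _ => hq j).1 h j (by simp)
  -- Draw (a, b) with mass `x a b`, then `i` and `j` independently from the fibres over a and b.
  -- Where a denominator is 0, division gives 0, which is right because `p i` or `q j` then
  -- vanishes.
  refine ⟨fun i j => p i * q j * (x (f i) (g j) / (r (f i) * c (g j))), fun i j => ?_,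
    fun i => ?_, fun j => ?_, fun a ha b hb => ?_⟩
  · have := hp i; have := hq j; have := hx (f i) (g j); have := hr0 (f i); have := hc0 (g j)
    positivity
  · rw [← sum_fiberwise_of_maps_to (t := Y) (g := g) fun j _ => hg j]
    have : ∀ b ∈ Y, ∑ j with g j = b, p i * q j * (x (f i) (g j) / (r (f i) * c (g j)))
        = p i / r (f i) * x (f i) b := by
      intro b hb
      rw [sum_congr rfl (g := fun j => q j * (p i * (x (f i) b / (r (f i) * c b))))
        fun j hj => by rw [(mem_filter.1 hj).2]; ring, ← sum_mul, hqx b hb]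
      change c b * _ = _
      by_cases h : c b = 0
      · rw [h, hxc b _ (hf i) h]; simp
      · field_simp
    rw [sum_congr rfl this, ← mul_sum]
    change p i / r (f i) * r (f i) = p i
    by_cases h : r (f i) = 0
    · simp [h, hpr i h]
    · field_simp
  · rw [← sum_fiberwise_of_maps_to (t := X) (g := f) fun i _ => hf i]
    have : ∀ a ∈ X, ∑ i with f i = a, p i * q j * (x (f i) (g j) / (r (f i) * c (g j)))
        = q j / c (g j) * x a (g j) := by
      intro a ha
      rw [sum_congr rfl (g := fun i => p i * (q j * (x a (g j) / (r a * c (g j)))))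
        fun i hi => by rw [(mem_filter.1 hi).2]; ring, ← sum_mul, hpx a ha]
      change r a * _ = _
      by_cases h : r a = 0
      · rw [h, hxr a _ (hg j) h]; simp
      · field_simp
    rw [sum_congr rfl this, ← mul_sum]
    change q j / c (g j) * c (g j) = q j
    by_cases h : c (g j) = 0
    · simp [h, hqc j h]
    · field_simp
  · have : ∑ i with f i = a, ∑ j with g j = b, p i * q j * (x (f i) (g j) / (r (f i) * c (g j)))
        = (∑ i with f i = a, p i) * (∑ j with g j = b, q j) * (x a b / (r a * c b)) := by
      rw [sum_mul_sum, sum_mul]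
      refine sum_congr rfl fun i hi => ?_
      rw [sum_mul]
      refine sum_congr rfl fun j hj => ?_
      rw [(mem_filter.1 hi).2, (mem_filter.1 hj).2]
    rw [this, hpx a ha, hqx b hb]
    change r a * c b * _ = _
    by_cases h : r a = 0
    · simp [h, hxr a b hb h]
    by_cases h' : c b = 0
    · simp [h', hxc b a ha h']
    field_simp

end coupling

/-! ### Contracting and gluing along a tight odd cut -/

section contraction

/-- The image of the weight `x` under the identification of vertices by `f`, loops dropped. -/
def contract {W : Type*} [DecidableEq W] (f : V → W) (x : V → V → ℝ) (a b : W) : ℝ :=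
  if a = b then 0 else ∑ p with f p = a, ∑ q with f q = b, x p q

omit [DecidableEq V] in
lemma contract_of_ne {W : Type*} [DecidableEq W] (f : V → W) (x : V → V → ℝ) {a b : W}
    (h : a ≠ b) : contract f x a b = ∑ p with f p = a, ∑ q with f q = b, x p q :=
  if_neg h

/-- Pairs crossing the cut lie in different fibres, so dropping loops loses nothing. -/
lemma cutSum_contract {W : Type*} [Fintype W] [DecidableEq W] (f : V → W) (x : V → V → ℝ)
    (Y : Finset W) : cutSum (contract f x) Y = cutSum x (univ.filter (f · ∈ Y)) := by
  have h1 : ∀ a ∈ Y, ∑ b ∈ Yᶜ, contract f x a b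
      = ∑ p with f p = a, ∑ q ∈ (univ.filter (f · ∈ Y))ᶜ, x p q := by
    intro a ha
    rw [sum_congr rfl fun b hb => contract_of_ne f x fun h : a = b => mem_compl.1 hb (h ▸ ha),
      sum_comm]
    refine sum_congr rfl fun p _ => ?_
    rw [← sum_fiberwise_of_maps_to (t := Yᶜ) (g := f) (by simp)]
    refine sum_congr rfl fun b hb => sum_congr ?_ fun _ _ => rfl
    ext q
    simp only [mem_filter, mem_univ, true_and, mem_compl]
    exact ⟨fun h => ⟨h ▸ mem_compl.1 hb, h⟩, fun h => h.2⟩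
  rw [cutSum, sum_congr rfl h1, cutSum,
    ← sum_fiberwise_of_maps_to (s := univ.filter (f · ∈ Y)) (t := Y) (g := f) (by simp)]
  refine sum_congr rfl fun a ha => sum_congr ?_ fun _ _ => rfl
  ext p
  simp only [mem_filter, mem_univ, true_and]
  exact ⟨fun h => ⟨h ▸ ha, h⟩, fun h => h.2⟩

/-- Identify all the vertices outside `X`. -/
def collapse (X : Finset V) (v : V) : Option X :=
  if h : v ∈ X then some ⟨v, h⟩ else none

omit [Fintype V] in
lemma collapse_of_mem {X : Finset V} {v : V} (h : v ∈ X) : collapse X v = some ⟨v, h⟩ :=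
  dif_pos h

lemma filter_collapse_eq_some {X : Finset V} (v : X) :
    univ.filter (fun w => collapse X w = some v) = {(v : V)} := by
  ext w
  by_cases h : w ∈ X
  · simp [collapse, h, Subtype.ext_iff]
  · have hne : w ≠ v := fun h' => h (h' ▸ v.2)
    simp [collapse, hne]

lemma filter_collapse_eq_none (X : Finset V) :
    univ.filter (fun w => collapse X w = none) = Xᶜ := by
  ext w
  by_cases h : w ∈ X <;> simp [collapse, h]

/-- Every fibre of `collapse X` is odd: a single vertex or `Xᶜ`. -/
lemma odd_card_filter_collapse {X : Finset V} (hX : Odd #Xᶜ) {Y : Finset (Option X)}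
    (hY : Odd #Y) : Odd #(univ.filter (collapse X · ∈ Y)) := by
  rw [card_eq_sum_card_fiberwise (f := collapse X) (t := Y) (by intro v; simp),
    odd_sum_iff_odd_card_odd, filter_true_of_mem]
  · exact hY
  · intro b hb
    have : (univ.filter (collapse X · ∈ Y)).filter (collapse X · = b)
        = univ.filter (collapse X · = b) := by
      ext v
      simp only [mem_filter, mem_univ, true_and]
      exact ⟨fun h => h.2, fun h => ⟨h ▸ hb, h⟩⟩
    rw [this]
    cases b with
    | none => rwa [filter_collapse_eq_none]
    | some v => simp [filter_collapse_eq_some]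

/-- Cuts of the contraction are cuts of `x`; tightness of `X` is what gives the new vertex row sum
1. -/
lemma IsFractionalMatching.contract_collapse {x : V → V → ℝ} (hx : IsFractionalMatching x)
    {X : Finset V} (hX : Odd #X) (hcut : cutSum x X = 1) :
    IsFractionalMatching (contract (collapse X) x) where
  nonneg a b := by
    unfold contract
    split_ifs
    · exact le_rfl
    · exact sum_nonneg fun _ _ => sum_nonneg fun _ _ => hx.nonneg _ _
  symm a b := by
    unfold contract
    rw [sum_comm]
    simp only [eq_comm (a := a), hx.symm]
  diag a := if_pos rfl
  row_sum a := by
    rw [← cutSum_singleton (x := contract (collapse X) x) (fun a => if_pos rfl), cutSum_contract]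
    simp only [mem_singleton]
    cases a with
    | none => rw [filter_collapse_eq_none, cutSum_compl hx.symm, hcut]
    | some v => rw [filter_collapse_eq_some, cutSum_singleton hx.diag, hx.row_sum]
  one_le_cutSum Y hY := by
    rw [cutSum_contract]
    exact hx.one_le_cutSum _ (odd_card_filter_collapse (hx.odd_card_compl hX) hY)

/-- `P` restricts to a perfect matching of `X` minus the vertex `c`. -/
structure IsNearMatching (X : Finset V) (P : V → V → ℤ) (c : V) : Prop where
  mem : c ∈ X
  zero_or_one : ∀ a b, P a b = 0 ∨ P a b = 1
  symm : ∀ a b, P a b = P b a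
  diag : ∀ a, P a a = 0
  row_sum : ∀ a ∈ X, ∑ b ∈ X, P a b = if c = a then 0 else 1

omit [Fintype V] in
-- The missed vertex `c` is the partner of the collapsed vertex `none`.
lemma IsMatchingMatrix.exists_isNearMatching {X : Finset V} {M : Option X → Option X → ℤ}
    (hM : IsMatchingMatrix M) :
    ∃ c : V, IsNearMatching X (fun a b => if a = b then 0 else M (collapse X a) (collapse X b)) c ∧
      ∀ a : X, M (some a) none = if c = a then 1 else 0 := by
  have h1 := hM.row_sum none
  rw [Fintype.sum_option, hM.diag, zero_add] at h1
  obtain ⟨c, hc⟩ : ∃ c : X, M none (some c) = 1 := by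
    by_contra! h
    rw [sum_eq_zero fun c _ => (hM.zero_or_one _ _).resolve_right (h c)] at h1
    exact zero_ne_one h1
  have hne : ∀ a : X, M (some a) none = if (c : V) = a then 1 else 0 := by
    intro a
    rw [hM.symm]
    split_ifs with h
    · rw [← Subtype.ext h, hc]
    · by_contra h0
      have h2 : M none (some a) = 1 := (hM.zero_or_one _ _).resolve_left h0
      have h3 : ∑ d ∈ {c, a}, M none (some d) ≤ 1 :=
        h1 ▸ sum_le_sum_of_subset_of_nonneg (subset_univ _) fun _ _ _ => hM.nonneg _ _
      rw [sum_pair fun h' => h (congrArg _ h')] at h3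
      omega
  refine ⟨c, ⟨c.2, fun a b => ?_, fun a b => ?_, fun a => if_pos rfl, fun a ha => ?_⟩, hne⟩
  · split_ifs
    · exact Or.inl rfl
    · exact hM.zero_or_one _ _
  · rw [hM.symm]
    simp only [eq_comm (a := a)]
  · have h2 := hM.row_sum (some ⟨a, ha⟩)
    rw [Fintype.sum_option, hne] at h2
    have h3 : ∑ b ∈ X, (if a = b then 0 else M (collapse X a) (collapse X b))
        = ∑ b : X, M (some ⟨a, ha⟩) (some b) := by
      rw [← sum_coe_sort X]
      refine sum_congr rfl fun b _ => ?_
      rw [collapse_of_mem ha, collapse_of_mem b.2]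
      split_ifs with h
      · rw [← hM.diag (some b)]
        exact congrArg (M · _) (congrArg _ (Subtype.ext h.symm))
      · rfl
    rw [h3]
    split_ifs at h2 ⊢ <;> omega

/-- A decomposition of the contraction of `x` along the complement of `X`, seen on `X`. -/
lemma exists_nearMatching_decomposition {x : V → V → ℝ} (hx : IsFractionalMatching x)
    {X : Finset V} (h : contract (collapse X) x ∈ convexHull ℝ (matchingMatrices (Option X))) :
    ∃ (ι : Type) (_ : Fintype ι) (p : ι → ℝ) (P : ι → V → V → ℤ) (c : ι → V),
      (∀ i, 0 ≤ p i) ∧ ∑ i, p i = 1 ∧ (∀ i, IsNearMatching X (P i) (c i)) ∧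
      (∀ a ∈ X, ∀ b ∈ X, ∑ i, p i * P i a b = x a b) ∧
      ∀ a ∈ X, ∑ i with c i = a, p i = ∑ b ∈ Xᶜ, x a b := by
  rw [mem_convexHull_iff_exists_fintype] at h
  obtain ⟨ι, hι, p, z, hp, hp1, hz, hsum⟩ := h
  choose M hM hzM using hz
  choose c hc hcM using fun i => (hM i).exists_isNearMatching
  have hval : ∀ a b, ∑ i, p i * (M i a b : ℝ) = contract (collapse X) x a b := by
    intro a b
    rw [← hsum]
    simp [hzM]
  refine ⟨ι, hι, p, _, c, hp, hp1, hc, fun a ha b hb => ?_, fun a ha => ?_⟩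
  · by_cases hab : a = b
    · simp [hab, hx.diag]
    · simp only [hab, if_false]
      rw [hval, collapse_of_mem ha, collapse_of_mem hb, contract_of_ne _ _ (by simpa using hab),
        filter_collapse_eq_some, filter_collapse_eq_some]
      simp
  · have := hval (some ⟨a, ha⟩) none
    rw [contract_of_ne _ _ (by simp), filter_collapse_eq_some, filter_collapse_eq_none,
      sum_singleton] at this
    rw [← this, sum_filter]
    refine sum_congr rfl fun i _ => ?_
    rw [hcM]
    split_ifs <;> simp

/-- Join near-perfect matchings of `X` and of its complement by the pair of missed vertices. -/
def glue (X : Finset V) (P Q : V → V → ℤ) (c d a b : V) : ℤ :=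
  if a ∈ X then if b ∈ X then P a b else if c = a ∧ d = b then 1 else 0
  else if b ∈ X then if c = b ∧ d = a then 1 else 0 else Q a b

lemma isMatchingMatrix_glue {X : Finset V} {P Q : V → V → ℤ} {c d : V}
    (hP : IsNearMatching X P c) (hQ : IsNearMatching Xᶜ Q d) :
    IsMatchingMatrix (glue X P Q c d) where
  zero_or_one a b := by
    have := hP.zero_or_one a b
    have := hQ.zero_or_one a b
    unfold glue
    split_ifs <;> simp_all
  symm a b := by
    by_cases ha : a ∈ X <;> by_cases hb : b ∈ X
    · simpa [glue, ha, hb] using hP.symm a b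
    · simp [glue, ha, hb]
    · simp [glue, ha, hb]
    · simpa [glue, ha, hb] using hQ.symm a b
  diag a := by
    unfold glue
    split_ifs
    · exact hP.diag a
    · exact hQ.diag a
  row_sum a := by
    have hc := hP.mem
    have hd := hQ.mem
    rw [← sum_add_sum_compl X]
    by_cases ha : a ∈ X
    · rw [sum_congr rfl (g := P a) fun b hb => by simp [glue, ha, hb],
        sum_congr rfl (s₁ := Xᶜ) (g := fun b => if d = b then if c = a then 1 else 0 else 0)
          fun b hb => by 
            by_cases h₁ : c = a <;> by_cases h₂ : d = b <;> simp [glue, ha, mem_compl.1 hb, h₁, h₂],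
        hP.row_sum a ha, sum_ite_eq, if_pos hd]
      split_ifs <;> rfl
    · rw [sum_congr rfl (s₁ := Xᶜ) (g := Q a) fun b hb => by simp [glue, ha, mem_compl.1 hb],
        sum_congr rfl (g := fun b => if c = b then if d = a then 1 else 0 else 0)
          fun b hb => by 
            by_cases h₁ : c = b <;> by_cases h₂ : d = a <;> simp [glue, ha, hb, h₁, h₂],
        hQ.row_sum a (mem_compl.2 ha), sum_ite_eq, if_pos hc]
      split_ifs <;> rfl

/-- In both decompositions the missed vertex is distributed as the matching marginal of `x` on `X ×
Xᶜ`. Coupling them so that the missed pair has mass exactly `x a b` recovers `x` across the cut; the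
marginals recover it on each side. -/
lemma mem_convexHull_of_contract {x : V → V → ℝ} (hx : IsFractionalMatching x) {X : Finset V}
    (h₁ : contract (collapse X) x ∈ convexHull ℝ (matchingMatrices (Option X)))
    (h₂ : contract (collapse Xᶜ) x ∈
      convexHull ℝ (matchingMatrices (Option (Xᶜ : Finset V)))) :
    x ∈ convexHull ℝ (matchingMatrices V) := by
  obtain ⟨ι, _, p, P, c, hp, hp1, hP, hPx, hcx⟩ := exists_nearMatching_decomposition hx h₁
  obtain ⟨κ, _, q, Q, d, hq, hq1, hQ, hQx, hdx⟩ := exists_nearMatching_decomposition hx h₂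
  rw [compl_compl] at hdx
  obtain ⟨w, hw, hwp, hwq, hwx⟩ := exists_coupling hx.nonneg hp hq (fun i => (hP i).mem)
    (fun j => (hQ j).mem) hcx fun b hb => by
      rw [hdx b hb]
      exact sum_congr rfl fun a _ => hx.symm b a
  refine mem_convexHull_of_exists_fintype (fun k : ι × κ => w k.1 k.2)
    (fun k a b => (glue X (P k.1) (Q k.2) (c k.1) (d k.2) a b : ℝ)) (fun k => hw _ _) ?_
    (fun k => ⟨_, isMatchingMatrix_glue (hP _) (hQ _), rfl⟩) ?_
  · rw [Fintype.sum_prod_type]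
    simp only [hwp, hp1]
  · have hcross : ∀ a ∈ X, ∀ b ∈ Xᶜ,
        ∑ i, ∑ j, w i j * (if c i = a ∧ d j = b then (1 : ℝ) else 0) = x a b := by
      intro a ha b hb
      rw [← hwx a ha b hb, sum_filter]
      refine sum_congr rfl fun i _ => ?_
      split_ifs with h
      · rw [sum_filter]
        exact sum_congr rfl fun j _ => by simp [h]
      · exact sum_eq_zero fun j _ => by simp [h]
    ext a b
    simp only [Finset.sum_apply, Pi.smul_apply, smul_eq_mul, Fintype.sum_prod_type]
    by_cases ha : a ∈ X <;> by_cases hb : b ∈ X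
    · simp only [glue, ha, hb, if_true, ← sum_mul, hwp]
      exact hPx a ha b hb
    · simp only [glue, ha, hb, if_true, if_false]
      push_cast
      exact hcross a ha b (mem_compl.2 hb)
    · simp only [glue, ha, hb, if_true, if_false]
      push_cast
      rw [hx.symm]
      exact hcross b hb a (mem_compl.2 ha)
    · simp only [glue, ha, hb, if_false]
      rw [sum_comm]
      simp only [← sum_mul, hwq]
      exact hQx a (mem_compl.2 ha) b (mem_compl.2 hb)

end contraction

/-! ### Extreme points and Edmonds' theorem -/

section extreme

lemma cutSum_sub_smul (x y : V → V → ℝ) (ε : ℝ) (X : Finset V) :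
    cutSum (fun a b => (x a b - ε * y a b) / (1 - ε)) X
      = (cutSum x X - ε * cutSum y X) / (1 - ε) := by
  simp only [cutSum, ← sum_div, sum_sub_distrib, mul_sum]

/-- Without nontrivial tight odd cuts, one can move away from a matching in the support. -/
lemma IsFractionalMatching.exists_sub_smul {x : V → V → ℝ} (hx : IsFractionalMatching x)
    (htight : ∀ X : Finset V, Odd #X → cutSum x X = 1 → #X = 1 ∨ #Xᶜ = 1)
    {M : V → V → ℤ} (hM : IsMatchingMatrix M) (hMx : ∀ a b, M a b ≠ 0 → 0 < x a b) :
    ∃ ε : ℝ, 0 < ε ∧ ε < 1 ∧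
      IsFractionalMatching fun a b => (x a b - ε * M a b) / (1 - ε) := by
  -- A trivial cut has weight 1 on the whole polytope, so tight constraints stay tight for every ε.
  -- The others are finitely many strict inequalities or nonnegativity constraints that survive for
  -- small ε.
  have hone : ∀ (y : V → V → ℝ), IsFractionalMatching y → ∀ X : Finset V,
      #X = 1 ∨ #Xᶜ = 1 → cutSum y X = 1 := by
    rintro y hy X (h | h)
    · obtain ⟨a, rfl⟩ := card_eq_one.1 h
      rw [cutSum_singleton hy.diag, hy.row_sum]
    · obtain ⟨a, h⟩ := card_eq_one.1 h
      rw [← cutSum_compl hy.symm, h, cutSum_singleton hy.diag, hy.row_sum]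
  have h1 : ∀ᶠ ε : ℝ in nhdsWithin 0 (Set.Ioi 0), ∀ a b, 0 ≤ x a b - ε * M a b := by
    rw [Filter.eventually_all]
    intro a
    rw [Filter.eventually_all]
    intro b
    by_cases h : M a b = 0
    · simp [h, hx.nonneg]
    · have ht : Filter.Tendsto (fun ε : ℝ => x a b - ε * M a b) (nhds 0) (nhds (x a b - 0 * M a b)) :=
        Continuous.tendsto (by fun_prop) 0
      refine Filter.Eventually.filter_mono nhdsWithin_le_nhds ?_
      filter_upwards [ht.eventually (lt_mem_nhds (a := 0) (by simpa using hMx a b h))] with ε hε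
      exact hε.le
  have h2 : ∀ᶠ ε : ℝ in nhdsWithin 0 (Set.Ioi 0), ∀ X : Finset V, Odd #X →
      1 - ε ≤ cutSum x X - ε * cutSum (fun a b => (M a b : ℝ)) X := by
    rw [Filter.eventually_all]
    intro X
    by_cases hX : Odd #X
    swap
    · exact Filter.Eventually.of_forall fun ε h => absurd h hX
    rcases (hx.one_le_cutSum X hX).eq_or_lt with h | h
    · have := hone _ hM.isFractionalMatching X (htight X hX h.symm)
      exact Filter.Eventually.of_forall fun ε _ => by rw [← h, this, mul_one]
    · have ht : Filter.Tendsto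
          (fun ε : ℝ => cutSum x X - ε * cutSum (fun a b => (M a b : ℝ)) X - (1 - ε)) (nhds 0)
          (nhds (cutSum x X - 0 * cutSum (fun a b => (M a b : ℝ)) X - (1 - 0))) :=
        Continuous.tendsto (by fun_prop) 0
      refine Filter.Eventually.filter_mono nhdsWithin_le_nhds ?_
      filter_upwards [ht.eventually (lt_mem_nhds (a := 0) (by simpa using h))] with ε hε _
      linarith
  have h3 : ∀ᶠ ε : ℝ in nhdsWithin 0 (Set.Ioi 0), ε < 1 :=
    Filter.Eventually.filter_mono nhdsWithin_le_nhds (gt_mem_nhds one_pos)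
  obtain ⟨ε, ⟨hε1, hε2, hε3⟩, hε0⟩ :=
    ((h1.and (h2.and h3)).and self_mem_nhdsWithin).exists
  have hpos : 0 < 1 - ε := by linarith
  refine ⟨ε, hε0, hε3, ⟨fun a b => div_nonneg (hε1 a b) hpos.le, fun a b => ?_, fun a => ?_,
    fun a => ?_, fun X hX => ?_⟩⟩
  · rw [hx.symm, hM.symm]
  · simp [hx.diag, hM.diag]
  · rw [← sum_div, sum_sub_distrib, hx.row_sum, ← mul_sum, ← Int.cast_sum, hM.row_sum]
    simp [hpos.ne']
  · rw [cutSum_sub_smul, le_div_iff₀ hpos, one_mul]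
    exact hε2 X hX

lemma isCompact_isFractionalMatching : IsCompact {x : V → V → ℝ | IsFractionalMatching x} := by
  have hbox : IsCompact (Set.univ.pi fun _ : V => Set.univ.pi fun _ : V => Set.Icc (0 : ℝ) 1) :=
    isCompact_univ_pi fun _ => isCompact_univ_pi fun _ => isCompact_Icc
  refine hbox.of_isClosed_subset ?_ ?_
  · have : {x : V → V → ℝ | IsFractionalMatching x} =
        {x | ∀ a b, 0 ≤ x a b} ∩ {x | ∀ a b, x a b = x b a} ∩ {x | ∀ a, x a a = 0} ∩
        {x | ∀ a, ∑ b, x a b = 1} ∩ {x | ∀ X : Finset V, Odd #X → 1 ≤ cutSum x X} := by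
      ext x
      exact ⟨fun h => ⟨⟨⟨⟨h.1, h.2⟩, h.3⟩, h.4⟩, h.5⟩, fun h =>
        ⟨h.1.1.1.1, h.1.1.1.2, h.1.1.2, h.1.2, h.2⟩⟩
    rw [this]
    simp only [Set.ofPred_forall, cutSum]
    refine ((((IsClosed.inter ?_ ?_).inter ?_).inter ?_).inter ?_)
    · exact isClosed_iInter fun a => isClosed_iInter fun b =>
        isClosed_le (by fun_prop) (by fun_prop)
    · exact isClosed_iInter fun a => isClosed_iInter fun b =>
        isClosed_eq (by fun_prop) (by fun_prop)
    · exact isClosed_iInter fun a => isClosed_eq (by fun_prop) (by fun_prop)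
    · exact isClosed_iInter fun a => isClosed_eq (by fun_prop) (by fun_prop)
    · exact isClosed_iInter fun a => isClosed_iInter fun _ =>
        isClosed_le (by fun_prop) (by fun_prop)
  · intro x hx a _ b _
    refine ⟨hx.nonneg a b, ?_⟩
    rw [← hx.row_sum a]
    exact single_le_sum (f := x a) (fun b _ => hx.nonneg a b) (mem_univ b)

lemma convex_isFractionalMatching : Convex ℝ {x : V → V → ℝ | IsFractionalMatching x} := by
  intro x hx y hy s t hs ht hst
  have hval : ∀ a b, (s • x + t • y) a b = s * x a b + t * y a b := fun a b => rfl
  refine ⟨fun a b => ?_, fun a b => ?_, fun a => ?_, fun a => ?_, fun X hX => ?_⟩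
  · rw [hval]
    have := hx.nonneg a b; have := hy.nonneg a b
    positivity
  · rw [hval, hval, hx.symm, hy.symm]
  · simp [hval, hx.diag, hy.diag]
  · simp only [hval, sum_add_distrib, ← mul_sum, hx.row_sum, hy.row_sum, mul_one, hst]
  · have : cutSum (s • x + t • y) X = s * cutSum x X + t * cutSum y X := by
      simp only [cutSum, hval, sum_add_distrib, mul_sum]
    rw [this]
    nlinarith [hx.one_le_cutSum X hX, hy.one_le_cutSum X hX]

/-- An extreme point without nontrivial tight odd cuts is a perfect matching. -/
lemma mem_matchingMatrices_of_extreme {x : V → V → ℝ}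
    (hx : x ∈ Set.extremePoints ℝ {x : V → V → ℝ | IsFractionalMatching x})
    (htight : ∀ X : Finset V, Odd #X → cutSum x X = 1 → #X = 1 ∨ #Xᶜ = 1) :
    x ∈ matchingMatrices V := by
  have hxf : IsFractionalMatching x := hx.1
  obtain ⟨M, hM, hMx⟩ := hxf.exists_isMatchingMatrix
  obtain ⟨ε, h0, h1, hy⟩ := hxf.exists_sub_smul htight hM hMx
  refine ⟨M, hM, ?_⟩
  have hpos : 0 < 1 - ε := by linarith
  refine (hx.2 hM.isFractionalMatching hy ⟨ε, 1 - ε, h0, hpos, by ring, ?_⟩).symm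
  ext a b
  simp only [Pi.add_apply, Pi.smul_apply, smul_eq_mul]
  field_simp
  ring

/-- **Edmonds' perfect matching polytope theorem** for the complete graph. -/
theorem IsFractionalMatching.mem_convexHull {V : Type u} [Fintype V] [DecidableEq V]
    {x : V → V → ℝ} (hx : IsFractionalMatching x) : x ∈ convexHull ℝ (matchingMatrices V) := by
  induction hn : Fintype.card V using Nat.strong_induction_on generalizing V with
  | _ n ih =>
    have hext : Set.extremePoints ℝ {x : V → V → ℝ | IsFractionalMatching x} ⊆
        convexHull ℝ (matchingMatrices V) := by
      intro y hy
      have hyf : IsFractionalMatching y := hy.1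
      by_cases htight : ∀ X : Finset V, Odd #X → cutSum y X = 1 → #X = 1 ∨ #Xᶜ = 1
      · exact subset_convexHull _ _ (mem_matchingMatrices_of_extreme hy htight)
      · push Not at htight
        obtain ⟨X, hX, hcut, hX1, hX2⟩ := htight
        have hXc := hyf.odd_card_compl hX
        have hcard := card_add_card_compl X
        obtain ⟨k, hk⟩ := hX
        obtain ⟨l, hl⟩ := hXc
        -- Both sides are odd and not of size 1, so each has at least 3 vertices and both
        -- contractions are smaller than `V`.
        refine mem_convexHull_of_contract hyf
          (ih (#X + 1) (by omega) (hyf.contract_collapse ⟨k, hk⟩ hcut) (by simp))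
          (ih (#Xᶜ + 1) (by omega) (hyf.contract_collapse ⟨l, hl⟩ ?_) ?_)
        · rw [cutSum_compl hyf.symm, hcut]
        · rw [Fintype.card_option, Fintype.card_coe]
    -- Krein–Milman; the closure is harmless since the hull of finitely many matchings is closed.
    have h := closure_convexHull_extremePoints (s := {x : V → V → ℝ | IsFractionalMatching x})
      isCompact_isFractionalMatching convex_isFractionalMatching
    have hx' : x ∈ {x : V → V → ℝ | IsFractionalMatching x} := hx
    rw [← h] at hx'
    exact closure_minimal (convexHull_min hext (convex_convexHull _ _))
      (finite_matchingMatrices.isClosed_convexHull ℝ) hx'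

end extreme

/-! ### Averaging over a decomposition into matchings -/

/-- A perfect matching that does at least as well as `x` on the pairs in `U` and crosses every
tight odd cut of `x` exactly once. -/
lemma IsFractionalMatching.exists_matching_le {x : V → V → ℝ} (hx : IsFractionalMatching x)
    (U : Finset (V × V)) :
    ∃ M : V → V → ℤ, IsMatchingMatrix M ∧ (∀ a b, M a b ≠ 0 → 0 < x a b) ∧
      (∀ X : Finset V, Odd #X → cutSum x X = 1 → cutSum M X = 1) ∧
      ∑ e ∈ U, x e.1 e.2 ≤ ∑ e ∈ U, (M e.1 e.2 : ℝ) := by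
  obtain ⟨ι, _, p, z, hp, hp1, hz, hsum⟩ := mem_convexHull_iff_exists_fintype.1 hx.mem_convexHull
  choose M hM hzM using hz
  have hval : ∀ a b, ∑ i, p i * (M i a b : ℝ) = x a b := by
    intro a b
    rw [← hsum]
    simp [hzM]
  have hU : ∑ i, p i * ∑ e ∈ U, x e.1 e.2 ≤ ∑ i, p i * ∑ e ∈ U, (M i e.1 e.2 : ℝ) := by
    rw [← sum_mul, hp1, one_mul]
    simp only [mul_sum]
    rw [sum_comm]
    simp only [hval, le_refl]
  obtain ⟨i, hi0, hi⟩ : ∃ i, 0 < p i ∧ ∑ e ∈ U, x e.1 e.2 ≤ ∑ e ∈ U, (M i e.1 e.2 : ℝ) := by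
    by_contra! h
    refine hU.not_gt (sum_lt_sum (fun i _ => ?_) ?_)
    · rcases (hp i).eq_or_lt with h0 | h0
      · simp [← h0]
      · exact mul_le_mul_of_nonneg_left (h i h0).le (hp i)
    · obtain ⟨i, hi⟩ : ∃ i, p i ≠ 0 := by
        by_contra! h0
        simp [h0] at hp1
      have hi0 := lt_of_le_of_ne (hp i) hi.symm
      exact ⟨i, mem_univ i, mul_lt_mul_of_pos_left (h i hi0) hi0⟩
  refine ⟨M i, hM i, fun a b hab => ?_, fun X hX hcut => ?_, hi⟩
  · rw [← hval]
    have hpos : ∀ j, 0 ≤ p j * (M j a b : ℝ) := fun j =>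
      mul_nonneg (hp j) (by exact_mod_cast (hM j).nonneg a b)
    refine sum_pos' (fun j _ => hpos j) ⟨i, mem_univ i, mul_pos hi0 ?_⟩
    exact_mod_cast lt_of_le_of_ne ((hM i).nonneg a b) hab.symm
  · have hcutsum : ∑ j, p j * ((cutSum (M j) X : ℤ) : ℝ) = 1 := by
      rw [← hcut]
      simp only [cutSum, Int.cast_sum, mul_sum]
      rw [sum_comm]
      refine sum_congr rfl fun a _ => ?_
      rw [sum_comm]
      exact sum_congr rfl fun b _ => hval a b
    -- Each matching has cut at least 1 and the weighted average is 1, so every matching of positive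
    -- weight attains 1.
    have hge : ∀ j, (1 : ℝ) ≤ (cutSum (M j) X : ℤ) := fun j => by
      exact_mod_cast (hM j).one_le_cutSum hX
    have hzero : ∑ j, p j * (((cutSum (M j) X : ℤ) : ℝ) - 1) = 0 := by
      simp only [mul_sub, sum_sub_distrib, hcutsum, mul_one, hp1, sub_self]
    have := (sum_eq_zero_iff_of_nonneg fun j _ =>
      mul_nonneg (hp j) (sub_nonneg.2 (hge j))).1 hzero i (mem_univ i)
    have h1 : ((cutSum (M i) X : ℤ) : ℝ) - 1 = 0 := (mul_eq_zero.1 this).resolve_left hi0.ne'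
    exact_mod_cast sub_eq_zero.1 h1

end PerfectMatchingPolytope

/-! ### Cuts of bridgeless cubic graphs -/

namespace PerfectMatchingPolytope

variable {V : Type*} [Fintype V]

/-- The adjacency matrix over `ℤ`, in function form. -/
def adjWeight (G : SimpleGraph V) [DecidableRel G.Adj] (a b : V) : ℤ :=
  if G.Adj a b then 1 else 0

section adjWeight

variable {G : SimpleGraph V} [DecidableRel G.Adj]

omit [Fintype V] in
lemma adjWeight_nonneg (a b : V) : 0 ≤ adjWeight G a b := by
  unfold adjWeight
  split_ifs <;> simp

omit [Fintype V] in
lemma adjWeight_symm (a b : V) : adjWeight G a b = adjWeight G b a := by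
  simp only [adjWeight, G.adj_comm]

omit [Fintype V] in
lemma adjWeight_diag (a : V) : adjWeight G a a = 0 := by
  simp [adjWeight]

lemma sum_adjWeight {k : ℕ} (hG : G.IsRegularOfDegree k) (a : V) :
    ∑ b, adjWeight G a b = k := by
  rw [← hG a, ← G.card_neighborFinset_eq_degree, G.neighborFinset_eq_filter]
  simp [adjWeight]

variable [DecidableEq V]

/-- If exactly one edge leaves `X`, it is a bridge. -/
lemma cutSum_adjWeight_ne_one (hG : G.IsBridgeless) (X : Finset V) :
    cutSum (adjWeight G) X ≠ 1 := by
  intro h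
  have hsum : ∑ e ∈ X ×ˢ Xᶜ, adjWeight G e.1 e.2 = 1 := by
    rw [sum_product]
    exact h
  obtain ⟨⟨a, b⟩, he, hne⟩ := exists_ne_zero_of_sum_ne_zero (hsum ▸ one_ne_zero)
  have hadj : G.Adj a b := by
    by_contra h'
    simp [adjWeight, h'] at hne
  have hab : adjWeight G a b = 1 := if_pos hadj
  have huniq : ∀ c ∈ X, ∀ d ∉ X, G.Adj c d → c = a ∧ d = b := by
    intro c hc d hd hcd
    have hmem : (c, d) ∈ X ×ˢ Xᶜ := by simp [hc, hd]
    by_contra hcon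
    have hle : ∑ e ∈ {(a, b), (c, d)}, adjWeight G e.1 e.2 ≤ 1 := by
      rw [← hsum]
      refine sum_le_sum_of_subset_of_nonneg ?_ fun e _ _ => adjWeight_nonneg _ _
      simp only [insert_subset_iff, singleton_subset_iff]
      exact ⟨he, hmem⟩
    have hcd1 : adjWeight G c d = 1 := if_pos hcd
    rw [sum_pair fun h => hcon (by simpa [eq_comm] using h)] at hle
    simp only [hab, hcd1] at hle
    omega
  refine hG s(a, b) hadj ?_
  rw [SimpleGraph.isBridge_iff]
  rintro ⟨p⟩
  -- A walk avoiding the only crossing edge cannot leave `X`.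
  have hinv : ∀ u v (p : (G.deleteEdges {s(a, b)}).Walk u v), u ∈ X → v ∈ X := by
    intro u v p
    induction p with
    | nil => exact id
    | cons hstep _ ih =>
      intro hu
      refine ih ?_
      by_contra hv
      rw [SimpleGraph.deleteEdges_adj] at hstep
      obtain ⟨rfl, rfl⟩ := huniq _ hu _ hv hstep.1
      exact hstep.2 rfl
  simp only [mem_product, mem_compl] at he
  exact he.2 (hinv a b p he.1)

/-- The cut is odd by parity, and it is not 1 because there is no bridge. -/
lemma three_le_cutSum_adjWeight (hcubic : G.IsRegularOfDegree 3) (hG : G.IsBridgeless)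
    {X : Finset V} (hX : Odd #X) : 3 ≤ cutSum (adjWeight G) X := by
  obtain ⟨k, hk⟩ := odd_cutSum (N := adjWeight G) adjWeight_symm adjWeight_diag (by decide)
    (sum_adjWeight hcubic) hX
  have h0 := cutSum_nonneg (x := adjWeight G) adjWeight_nonneg X
  have h1 := cutSum_adjWeight_ne_one hG X
  omega

end adjWeight

variable [DecidableEq V]

/-! ### Residual weights and the greedy choice -/

/-- After `i` perfect matchings of the cubic graph `G` have been chosen, `N` is an integral multiple
of a point of the perfect matching polytope, which is large on the set `U` of uncovered pairs. -/
structure IsResidualWeight (G : SimpleGraph V) [DecidableRel G.Adj] (i : ℕ) (N : V → V → ℤ)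
    (U : Finset (V × V)) : Prop where
  nonneg : ∀ a b, 0 ≤ N a b
  symm : ∀ a b, N a b = N b a
  adj : ∀ a b, N a b ≠ 0 → G.Adj a b
  row_sum : ∀ a, ∑ b, N a b = 2 * i + 3
  le_cutSum : ∀ X : Finset V, Odd #X → 2 * (i : ℤ) + 3 ≤ cutSum N X
  eq_on : ∀ e ∈ U, N e.1 e.2 = i + 1

namespace IsResidualWeight

variable {G : SimpleGraph V} [DecidableRel G.Adj] {i : ℕ} {N : V → V → ℤ} {U : Finset (V × V)}

lemma diag (h : IsResidualWeight G i N U) (a : V) : N a a = 0 := by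
  by_contra h'
  exact (h.adj a a h').ne rfl

lemma isFractionalMatching (h : IsResidualWeight G i N U) :
    IsFractionalMatching fun a b => (N a b : ℝ) / (2 * i + 3) where
  nonneg a b := by
    have : (0 : ℝ) ≤ N a b := by exact_mod_cast h.nonneg a b
    positivity
  symm a b := by rw [h.symm]
  diag a := by simp [h.diag]
  row_sum a := by
    rw [← sum_div, div_eq_one_iff_eq (by positivity)]
    exact_mod_cast h.row_sum a
  one_le_cutSum X hX := by
    have : cutSum (fun a b => (N a b : ℝ) / (2 * i + 3)) X = (cutSum N X : ℤ) / (2 * i + 3) := by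
      simp [cutSum, sum_div]
    rw [this, le_div_iff₀ (by positivity), one_mul]
    exact_mod_cast h.le_cutSum X hX

lemma zero (hcubic : G.IsRegularOfDegree 3) (hG : G.IsBridgeless) :
    IsResidualWeight G 0 (adjWeight G) (univ.filter fun e => G.Adj e.1 e.2) where
  nonneg := adjWeight_nonneg
  symm := adjWeight_symm
  adj a b h := by
    by_contra h'
    simp [adjWeight, h'] at h
  row_sum a := by simpa using sum_adjWeight hcubic a
  le_cutSum X hX := by simpa using three_le_cutSum_adjWeight hcubic hG hX
  eq_on e he := by simpa [adjWeight] using he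

/-- The greedy step: a perfect matching covering at least the average part of `U`. -/
lemma exists_step (h : IsResidualWeight G i N U) (hcubic : G.IsRegularOfDegree 3)
    (hG : G.IsBridgeless) :
    ∃ M : V → V → ℤ, IsMatchingMatrix M ∧ (∀ a b, M a b ≠ 0 → G.Adj a b) ∧
      IsResidualWeight G (i + 1) (fun a b => N a b + adjWeight G a b - M a b)
        (U.filter fun e => M e.1 e.2 = 0) ∧
      (#(U.filter fun e => M e.1 e.2 = 0) : ℝ) ≤ #U * ((i + 2) / (2 * i + 3)) := by
  obtain ⟨M, hM, hMN, htight, hU⟩ := h.isFractionalMatching.exists_matching_le U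
  have hpos : (0 : ℝ) < 2 * i + 3 := by positivity
  have hN : ∀ a b, M a b ≠ 0 → 1 ≤ N a b := by
    intro a b hab
    have h1 := hMN a b hab
    rw [div_pos_iff_of_pos_right hpos] at h1
    exact_mod_cast h1
  have hMG : ∀ a b, M a b ≠ 0 → G.Adj a b := fun a b hab => h.adj a b (by have := hN a b hab; omega)
  have hle : ∀ a b, M a b ≤ N a b := by
    intro a b
    rcases hM.zero_or_one a b with h0 | h1
    · rw [h0]; exact h.nonneg a b
    · rw [h1]; exact hN a b (by simp [h1])
  have hMA : ∀ a b, M a b ≤ adjWeight G a b := by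
    intro a b
    rcases hM.zero_or_one a b with h0 | h1
    · rw [h0]; exact adjWeight_nonneg a b
    · rw [h1, adjWeight, if_pos (hMG a b (by simp [h1]))]
  have hUG : ∀ e ∈ U, G.Adj e.1 e.2 := fun e he => h.adj _ _ (by rw [h.eq_on e he]; omega)
  refine ⟨M, hM, hMG, ⟨fun a b => ?_, fun a b => ?_, fun a b hab => ?_, fun a => ?_,
    fun X hX => ?_, fun e he => ?_⟩, ?_⟩
  · have := hle a b
    have := adjWeight_nonneg (G := G) a b
    linarith
  · simp only [h.symm a b, adjWeight_symm a b, hM.symm a b]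
  · by_contra hnadj
    have h1 : N a b = 0 := by by_contra h'; exact hnadj (h.adj a b h')
    have h2 : M a b = 0 := by by_contra h'; exact hnadj (hMG a b h')
    exact hab (by simp [h1, h2, adjWeight, hnadj])
  · simp only [sum_sub_distrib, sum_add_distrib, h.row_sum, sum_adjWeight hcubic, hM.row_sum]
    push_cast
    ring
  · have hcut : cutSum (fun a b => N a b + adjWeight G a b - M a b) X
        = cutSum N X + cutSum (adjWeight G) X - cutSum M X := by
      simp only [cutSum, sum_sub_distrib, sum_add_distrib]
    have h1 := h.le_cutSum X hX
    have h3 := three_le_cutSum_adjWeight hcubic hG hX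
    have hMA' : cutSum M X ≤ cutSum (adjWeight G) X :=
      sum_le_sum fun a _ => sum_le_sum fun b _ => hMA a b
    obtain ⟨k, hk⟩ := odd_cutSum h.symm h.diag ⟨(i : ℤ) + 1, by ring⟩ h.row_sum hX
    rw [hcut]
    push_cast
    -- The target is 2i+5. A tight cut gains at least 3 and loses exactly 1. Any other has, by
    -- parity, weight at least 2i+5 already, and does not decrease because `M` is at most the
    -- adjacency matrix.
    rcases h1.eq_or_lt with h1 | h1
    · have := htight X hX (by
        simp only [cutSum, ← sum_div]
        rw [div_eq_one_iff_eq hpos.ne']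
        exact_mod_cast h1.symm)
      omega
    · omega
  · rw [mem_filter] at he
    simp only [he.2, h.eq_on e he.1, adjWeight, if_pos (hUG e he.1)]
    push_cast
    ring
  · have h1 : ∑ e ∈ U, (N e.1 e.2 : ℝ) / (2 * i + 3) = #U * ((i + 1) / (2 * i + 3)) := by
      rw [sum_congr rfl fun e he => by rw [h.eq_on e he], sum_const, nsmul_eq_mul]
      push_cast
      rfl
    have h2 : ∑ e ∈ U, (M e.1 e.2 : ℝ) = #(U.filter fun e => ¬ M e.1 e.2 = 0) := by
      rw [card_filter]
      push_cast
      refine sum_congr rfl fun e _ => ?_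
      rcases hM.zero_or_one e.1 e.2 with h0 | h0 <;> simp [h0]
    have h3 : (#(U.filter fun e => M e.1 e.2 = 0) : ℝ) + #(U.filter fun e => ¬ M e.1 e.2 = 0) = #U := by
      exact_mod_cast card_filter_add_card_filter_not (s := U) fun e => M e.1 e.2 = 0
    rw [h1, h2] at hU
    have h4 : (#U : ℝ) * ((i + 2) / (2 * i + 3)) = #U - #U * ((i + 1) / (2 * i + 3)) := by
      field_simp
      ring
    linarith

end IsResidualWeight

/-- Greedily chosen perfect matchings of a bridgeless cubic graph (Kaiser, Král', Norine). -/
lemma exists_matchings {G : SimpleGraph V} [DecidableRel G.Adj] (hcubic : G.IsRegularOfDegree 3)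
    (hG : G.IsBridgeless) (t : ℕ) :
    ∃ (M : Fin t → V → V → ℤ) (N : V → V → ℤ) (U : Finset (V × V)),
      (∀ i, IsMatchingMatrix (M i)) ∧ (∀ i a b, M i a b ≠ 0 → G.Adj a b) ∧
      IsResidualWeight G t N U ∧ (∀ a b, (a, b) ∈ U ↔ G.Adj a b ∧ ∀ i, M i a b = 0) ∧
      (#U : ℝ) ≤ 2 * #G.edgeFinset * ∏ i ∈ range t, ((i + 2 : ℝ) / (2 * i + 3)) := by
  induction t with
  | zero =>
    refine ⟨Fin.elim0, _, _, fun i => i.elim0, fun i => i.elim0, .zero hcubic hG, by simp, ?_⟩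
    -- `U` consists of ordered pairs, so every edge counts twice.
    have h : (#(univ.filter fun e : V × V => G.Adj e.1 e.2) : ℤ) = ∑ a, (G.degree a : ℤ) := by
      rw [card_filter, Fintype.sum_prod_type]
      push_cast
      refine sum_congr rfl fun a _ => ?_
      rw [hcubic a]
      exact sum_adjWeight hcubic a
    have h' : #(univ.filter fun e : V × V => G.Adj e.1 e.2) = 2 * #G.edgeFinset := by
      rw [← G.sum_degrees_eq_twice_card_edges]
      exact_mod_cast h
    simp [h']
  | succ t ih =>
    obtain ⟨M, N, U, hM, hMG, hN, hU, hcard⟩ := ih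
    obtain ⟨M', hM', hMG', hN', hcard'⟩ := hN.exists_step hcubic hG
    refine ⟨Fin.snoc M M', _, _, fun i => ?_, fun i => ?_, hN', fun a b => ?_, ?_⟩
    · refine Fin.lastCases ?_ (fun i => ?_) i
      · simpa using hM'
      · simpa using hM i
    · refine Fin.lastCases ?_ (fun i => ?_) i
      · simpa using hMG'
      · simpa using hMG i
    · rw [mem_filter, hU, Fin.forall_fin_succ']
      simp [and_assoc]
    · rw [prod_range_succ, ← mul_assoc]
      exact hcard'.trans (mul_le_mul_of_nonneg_right hcard (by positivity))

/-! ### Numerical estimate of the product -/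

section estimate

/-- The inequality fails for t ≤ 4, hence the start at 5. -/
lemma prod_le_sqrt_div {t : ℕ} (ht : 5 ≤ t) :
    ∏ i ∈ range t, ((i + 2 : ℝ) / (2 * i + 3)) ≤ Real.sqrt t / 2 ^ t := by
  induction t, ht using Nat.le_induction with
  | base =>
    -- At t = 5 the product times 2^5 is 1536/693, just below 2.217.
    have : (2217 / 1000 : ℝ) ≤ Real.sqrt (5 : ℕ) := Real.le_sqrt_of_sq_le (by norm_num)
    rw [le_div_iff₀ (by positivity)]
    refine le_trans ?_ this
    norm_num [prod_range_succ]
  | succ t ht ih =>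
    rw [prod_range_succ]
    refine (mul_le_mul_of_nonneg_right ih (by positivity)).trans ?_
    -- Squared, this reads 4t³+16t²+16t ≤ 4t³+16t²+21t+9.
    have h : Real.sqrt t * (2 * (t + 2)) ≤ Real.sqrt ((t + 1 : ℕ)) * (2 * t + 3) := by
      refine (sq_le_sq₀ (by positivity) (by positivity)).1 ?_
      rw [mul_pow, mul_pow (√_), Real.sq_sqrt (by positivity), Real.sq_sqrt (by positivity)]
      push_cast
      have : (0 : ℝ) ≤ t := by positivity
      nlinarith
    rw [div_mul_div_comm, div_le_div_iff₀ (by positivity) (by positivity), pow_succ]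
    have := mul_le_mul_of_nonneg_right h (show (0 : ℝ) ≤ 2 ^ t by positivity)
    nlinarith

lemma mul_prod_lt_one {m t : ℕ} (ht : 0 < t) (h : (m : ℝ) < 2 ^ t / Real.sqrt t) :
    (m : ℝ) * ∏ i ∈ range t, ((i + 2 : ℝ) / (2 * i + 3)) < 1 := by
  have hs : 0 < Real.sqrt t := Real.sqrt_pos.2 (by exact_mod_cast ht)
  rw [lt_div_iff₀ hs] at h
  rcases le_or_gt 5 t with h5 | h5
  · calc (m : ℝ) * ∏ i ∈ range t, ((i + 2 : ℝ) / (2 * i + 3))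
        ≤ m * (Real.sqrt t / 2 ^ t) := mul_le_mul_of_nonneg_left (prod_le_sqrt_div h5) (by positivity)
      _ < 1 := by rwa [← mul_div_assoc, div_lt_one (by positivity)]
  -- For t = 1, 2, 3, 4 integrality of `m` helps: it is at most 1, 2, 4, 7, against products 2/3,
  -- 2/5, 8/35, 8/63.
  · have hsq : (m : ℝ) ^ 2 * t < (2 ^ t) ^ 2 := by
      have := pow_lt_pow_left₀ h (by positivity) two_ne_zero
      rwa [mul_pow, Real.sq_sqrt (by positivity)] at this
    have hsq' : m ^ 2 * t < (2 ^ t) ^ 2 := by exact_mod_cast hsq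
    have hm : ∀ k : ℕ, m ≤ k → (m : ℝ) ≤ k := fun k hk => by exact_mod_cast hk
    interval_cases t
    · have := hm 1 (by nlinarith)
      norm_num [prod_range_succ]
      push_cast at this
      linarith
    · have := hm 2 (by nlinarith)
      norm_num [prod_range_succ]
      push_cast at this
      linarith
    · have := hm 4 (by nlinarith)
      norm_num [prod_range_succ]
      push_cast at this
      linarith
    · have := hm 7 (by nlinarith)
      norm_num [prod_range_succ]
      push_cast at this
      linarith

end estimate

/-! ### From matrices to subgraphs, and the conclusion -/

/-- The subgraph of `G` given by a matching matrix. -/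
def IsMatchingMatrix.toSubgraph {G : SimpleGraph V} {M : V → V → ℤ} (hM : IsMatchingMatrix M)
    (hMG : ∀ a b, M a b ≠ 0 → G.Adj a b) : G.Subgraph where
  verts := Set.univ
  Adj a b := M a b ≠ 0
  adj_sub h := hMG _ _ h
  edge_vert _ := trivial
  symm := ⟨fun a b h => by rwa [hM.symm]⟩

lemma IsMatchingMatrix.isPerfectMatching_toSubgraph {G : SimpleGraph V} {M : V → V → ℤ}
    (hM : IsMatchingMatrix M) (hMG : ∀ a b, M a b ≠ 0 → G.Adj a b) :
    (hM.toSubgraph hMG).IsPerfectMatching := by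
  rw [SimpleGraph.Subgraph.isPerfectMatching_iff]
  intro a
  have hrow := hM.row_sum a
  obtain ⟨b, -, hb⟩ := exists_ne_zero_of_sum_ne_zero (hrow ▸ one_ne_zero)
  refine ⟨b, hb, fun c hc => ?_⟩
  by_contra hcb
  have hle : ∑ d ∈ {c, b}, M a d ≤ 1 :=
    hrow ▸ sum_le_sum_of_subset_of_nonneg (subset_univ _) fun _ _ _ => hM.nonneg _ _
  rw [sum_pair hcb, (hM.zero_or_one a b).resolve_left hb, (hM.zero_or_one a c).resolve_left hc]
    at hle
  omega

end PerfectMatchingPolytope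

open PerfectMatchingPolytope in
theorem theorem4p1 {V : Type*} [Fintype V] (G : SimpleGraph V) [DecidableRel G.Adj]
    (hconn : G.Connected) (hcubic : G.IsRegularOfDegree 3) (hbridge : G.IsBridgeless)
    (t : ℕ) (ht : 0 < t)
    (hsize : (G.edgeFinset.card : ℝ) < 2 ^ t / Real.sqrt t) :
    G.IsCoveredByPerfectMatchings t := by
  classical
  obtain ⟨M, N, U, hM, hMG, hN, hU, hcard⟩ := exists_matchings hcubic hbridge t
  refine ⟨fun i => (hM i).toSubgraph (hMG i),
    fun i => (hM i).isPerfectMatching_toSubgraph (hMG i), ?_⟩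
  refine Set.Subset.antisymm (Set.iUnion_subset fun i => SimpleGraph.Subgraph.edgeSet_subset _) ?_
  intro e
  induction e using Sym2.ind with
  | _ a b =>
    intro hab
    by_contra hcon
    have hzero : ∀ i, M i a b = 0 := by
      intro i
      by_contra h
      exact hcon (Set.mem_iUnion.2 ⟨i, h⟩)
    have hmem : (a, b) ∈ U := (hU a b).2 ⟨hab, hzero⟩
    have hmem' : (b, a) ∈ U := (hU b a).2 ⟨SimpleGraph.Adj.symm hab, fun i => by rw [(hM i).symm, hzero]⟩
    -- An uncovered edge puts both its orientations in `U`, whereas the estimate gives `#U < 2`.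
    have h2 : 2 ≤ #U := by
      rw [← Finset.card_pair (a := (a, b)) (b := (b, a)) fun h => hab.ne (congrArg Prod.fst h)]
      exact Finset.card_le_card (by simp [Finset.insert_subset_iff, hmem, hmem'])
    have h2' : (2 : ℝ) ≤ #U := by exact_mod_cast h2
    have h1 := mul_prod_lt_one ht hsize
    linarith
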